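/- Let $L\in\mathbb{R}$, and let $Y$ be a real random variable with law $P_Y$ and cumulative distribution function $F_Y(t)=\Pr(Y\le t)$, taking values in $[-L,L]$. For $w_1,w_2\in\mathbb{R}$ put $$\mathrm{Err}(w_1,w_2)=\mathbb{E}_Y\bigl|\,Y-2w_1F_Y(Y)-2w_2(1-F_Y(Y))\,\bigr| .$$ Let $y_1,\dots,y_{n_Y}$ ($n_Y\ge 1$) be i.i.d. samples from $P_Y$, let $\hat F_Y(t)=\frac1{n_Y}\sum_{i=1}^{n_Y}\mathbf 1[y_i\le t]$ be their empirical distribution function, and put $$\widehat{\mathrm{Err}}(w_1,w_2)=\frac1{n_Y}\sum_{i=1}^{n_Y}\bigl|\,y_i-2w_1\hat F_Y(y_i)-2w_2(1-\hat F_Y(y_i))\,\bigr| .$$ Then there is a constant $C>0$ depending only on $L$ (not on $P_Y$, $n_Y$, $\delta$, $w_1$, $w_2$) such that, for every $\delta\in(0,1)$, with probability at least $1-2\delta$, $$\bigl|\mathrm{Err}(w_1,w_2)-\widehat{\mathrm{Err}}(w_1,w_2)\bigr|\le C\sqrt{\frac{\log(1/\delta)}{n_Y}}\qquad\text{simultaneously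 for all } w_1,w_2\in[-L,L].$$ -/

import Mathlib

open MeasureTheory ProbabilityTheory

noncomputable section

/-- The error functional `Err(w₁, w₂) = E_Y |Y - 2 w₁ F_Y(Y) - 2 w₂ (1 - F_Y(Y))|`, where `P` is the
law of `Y` and `F_Y = cdf P` is its cumulative distribution function. -/
def Err (P : Measure ℝ) (w₁ w₂ : ℝ) : ℝ :=
  ∫ y, |y - 2 * w₁ * cdf P y - 2 * w₂ * (1 - cdf P y)| ∂P

/-- The empirical cumulative distribution function `t ↦ (1/n) ∑ᵢ 𝟙[yᵢ ≤ t]` of a sample `y`. -/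
def empCDF {n : ℕ} (y : Fin n → ℝ) (t : ℝ) : ℝ :=
  (1 / (n : ℝ)) * ∑ i, if y i ≤ t then (1 : ℝ) else 0

/-- The plug-in version of `Err`: the expectation over the law of `Y` is replaced by the empirical
mean over the sample `y`, and the distribution function by the empirical one. -/
def ErrHat {n : ℕ} (y : Fin n → ℝ) (w₁ w₂ : ℝ) : ℝ :=
  (1 / (n : ℝ)) * ∑ i, |y i - 2 * w₁ * empCDF y (y i) - 2 * w₂ * (1 - empCDF y (y i))|

end

/-! The argument is a uniform bound on the empirical distribution function followed by a
deterministic estimate, so uniformity in `w₁, w₂` needs no covering argument.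

Probabilistic half: as `B` shrinks along a chain, `centredCount P B` is a martingale, because a
sample point known to lie in `A` falls in `B ⊆ A` with probability `P(B)/P(A)`. Its summands lie in
`[-1, 1]` when `P(B) ≥ 1/2`, so Doob's inequality for its exponential and Hoeffding's lemma bound
the maximum over the whole chain at the price of one set. The half-lines `Ioi t` below the median
and `Iic t` above it form two such chains, and this gives `dvoretzky_kiefer_wolfowitz`.

Deterministic half: a Kolmogorov distance `ε` controls integrals of bounded monotone functions by
layer cake (`abs_integral_sub_le_of_monotone`). The integrand of `Err` is `|f - g|` with `f`, `g`
monotone, hence a combination of monotone functions. -/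

/-- The sum `∑ᵢ (𝟙[yᵢ ∈ B] / P(B) - 1)`, which is centred when the `yᵢ` have law `P`. -/
noncomputable def centredCount (P : Measure ℝ) (B : Set ℝ) {n : ℕ} (y : Fin n → ℝ) : ℝ :=
  ∑ i, (B.indicator 1 (y i) / P.real B - 1)

/-! ### Elementary properties of centred counts -/

theorem abs_indicator_div_sub_one_le {P : Measure ℝ} {B : Set ℝ} (hB : 1 / 2 ≤ P.real B) (u : ℝ) :
    |B.indicator 1 u / P.real B - 1| ≤ 1 := by
  have h0 : 0 < P.real B := by linarith
  by_cases hu : u ∈ B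
  · have h1 : 1 / P.real B ≤ 2 := by rw [div_le_iff₀ h0]; linarith
    have h2 : 0 < 1 / P.real B := by positivity
    rw [Set.indicator_of_mem hu, Pi.one_apply, abs_le]
    constructor <;> linarith
  · simp [Set.indicator_of_notMem hu]

theorem abs_centredCount_le {P : Measure ℝ} {B : Set ℝ} (hB : 1 / 2 ≤ P.real B) {n : ℕ}
    (y : Fin n → ℝ) : |centredCount P B y| ≤ n := by
  refine (Finset.abs_sum_le_sum_abs _ _).trans ?_
  refine (Finset.sum_le_sum fun i _ => abs_indicator_div_sub_one_le hB (y i)).trans ?_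
  simp

theorem measurable_centredCount (P : Measure ℝ) {B : Set ℝ} (hB : MeasurableSet B) (n : ℕ) :
    Measurable (centredCount P B : (Fin n → ℝ) → ℝ) := by
  refine Finset.measurable_fun_sum _ fun i _ => ?_
  exact (((measurable_one.indicator hB).comp (measurable_pi_apply i)).div_const _).sub_const _

/-- Moving a point inside `A` is invisible to every larger set. This invariance plays the role of
measurability with respect to the past, so no filtration is needed. -/
theorem centredCount_update (P : Measure ℝ) {A B : Set ℝ} (hAB : A ⊆ B) {n : ℕ} (y : Fin n → ℝ)
    (i : Fin n) {u v : ℝ} (hu : u ∈ A) (hv : v ∈ A) :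
    centredCount P B (Function.update y i u) = centredCount P B (Function.update y i v) := by
  refine Finset.sum_congr rfl fun j _ => ?_
  by_cases h : j = i
  · subst h
    simp [Set.indicator_of_mem (hAB hu), Set.indicator_of_mem (hAB hv)]
  · simp [Function.update_of_ne h]

theorem abs_exp_mul_centredCount_le {P : Measure ℝ} {n : ℕ} (θ : ℝ) {B : Set ℝ}
    (hPB : 1 / 2 ≤ P.real B)
    (y : Fin n → ℝ) : |Real.exp (θ * centredCount P B y)| ≤ Real.exp (|θ| * n) := by
  rw [abs_of_pos (Real.exp_pos _)]
  refine Real.exp_le_exp.2 ((le_abs_self _).trans ?_)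
  rw [abs_mul]
  exact mul_le_mul_of_nonneg_left (abs_centredCount_le hPB y) (abs_nonneg θ)

/-! ### Martingale property and maximal inequality along a chain -/

section Martingale

variable {Ω : Type*} [MeasurableSpace Ω] {μ : Measure Ω} {P : Measure ℝ} {n : ℕ} {Y : Fin n → Ω → ℝ}

/-- Where `Y i ∈ B`, the `i`-th coordinate may be frozen at `u₀` without changing `G`. The frozen
value is independent of `Y i`, and the normalised indicator has mean one. The result does not
involve `B`, whence the martingale property. -/
theorem integral_mul_indicator_div (hm : ∀ i, Measurable (Y i)) (hl : ∀ i, HasLaw (Y i) P μ)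
    (hi : iIndepFun Y μ) {G : (Fin n → ℝ) → ℝ} (hG : Measurable G) {A B : Set ℝ}
    (hB : MeasurableSet B) (hBA : B ⊆ A) (hPB : P.real B ≠ 0) (i : Fin n)
    (hGA : ∀ y u v, u ∈ A → v ∈ A → G (Function.update y i u) = G (Function.update y i v))
    {u₀ : ℝ} (hu₀ : u₀ ∈ A) :
    ∫ ω, G (fun j => Y j ω) * (B.indicator 1 (Y i ω) / P.real B) ∂μ
      = ∫ ω, G (Function.update (fun j => Y j ω) i u₀) ∂μ := by
  have hpt : ∀ ω, G (fun j => Y j ω) * (B.indicator 1 (Y i ω) / P.real B)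
      = G (Function.update (fun j => Y j ω) i u₀) * (B.indicator 1 (Y i ω) / P.real B) := by
    intro ω
    by_cases h : Y i ω ∈ B
    · rw [hGA (fun j => Y j ω) u₀ (Y i ω) hu₀ (hBA h)]
      congr 2
      exact (Function.update_eq_self i (fun j => Y j ω)).symm
    · simp [Set.indicator_of_notMem h]
  simp_rw [hpt]
  have hind := hi.indepFun_finset (S := {i}ᶜ) (T := {i}) disjoint_compl_left hm
  let φ : (({i}ᶜ : Finset (Fin n)) → ℝ) → ℝ := fun z =>
    G (fun j => if h : j ∈ ({i}ᶜ : Finset (Fin n)) then z ⟨j, h⟩ else u₀)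
  let ψ : (({i} : Finset (Fin n)) → ℝ) → ℝ := fun z =>
    B.indicator 1 (z ⟨i, Finset.mem_singleton_self i⟩) / P.real B
  have hφ : Measurable φ := by
    refine hG.comp (measurable_pi_lambda _ fun j => ?_)
    by_cases h : j ∈ ({i}ᶜ : Finset (Fin n))
    · simp only [h, dite_true]; exact measurable_pi_apply _
    · simp only [h, dite_false]; exact measurable_const
  have hψ : Measurable ψ :=
    ((measurable_one.indicator hB).comp (measurable_pi_apply _)).div_const _
  have h1 : (fun ω => G (Function.update (fun j => Y j ω) i u₀))
      = φ ∘ fun ω (j : ({i}ᶜ : Finset (Fin n))) => Y j ω := by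
    funext ω
    simp only [φ, Function.comp]
    congr 1
    funext j
    by_cases h : j = i
    · subst h; simp
    · simp [h]
  have h2 : (fun ω => B.indicator 1 (Y i ω) / P.real B)
      = ψ ∘ fun ω (j : ({i} : Finset (Fin n))) => Y j ω := rfl
  have hind' := hind.comp hφ hψ
  rw [← h1, ← h2] at hind'
  have hup : Measurable fun ω => G (Function.update (fun j => Y j ω) i u₀) := by
    rw [h1]; exact hφ.comp (measurable_pi_lambda _ fun j => hm j)
  have hindic : Measurable fun ω => B.indicator (1 : ℝ → ℝ) (Y i ω) / P.real B :=
    ((measurable_one.indicator hB).comp (hm i)).div_const _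
  rw [hind'.integral_fun_mul_eq_mul_integral hup.aestronglyMeasurable hindic.aestronglyMeasurable]
  have h3 : ∫ ω, B.indicator (1 : ℝ → ℝ) (Y i ω) / P.real B ∂μ = 1 := by
    rw [integral_div, ← div_self hPB]
    congr 1
    exact ((hl i).integral_comp (f := B.indicator (1 : ℝ → ℝ))
      (measurable_one.indicator hB).aestronglyMeasurable).trans (integral_indicator_one hB)
  rw [h3, mul_one]

variable [IsProbabilityMeasure μ]

theorem integrable_comp_of_bound (hm : ∀ i, Measurable (Y i)) {G : (Fin n → ℝ) → ℝ}
    (hG : Measurable G) {c : ℝ} (hc : ∀ y, |G y| ≤ c) :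
    Integrable (fun ω => G fun j => Y j ω) μ :=
  Integrable.of_bound (hG.comp (measurable_pi_lambda _ hm)).aestronglyMeasurable c
    (ae_of_all _ fun _ => hc _)

/-- Along a decreasing chain of sets, `centredCount` has orthogonal increments. -/
theorem integral_mul_centredCount_sub_eq_zero (hm : ∀ i, Measurable (Y i))
    (hl : ∀ i, HasLaw (Y i) P μ) (hi : iIndepFun Y μ) {G : (Fin n → ℝ) → ℝ} (hG : Measurable G)
    {c : ℝ} (hc : ∀ y, |G y| ≤ c) {A B : Set ℝ} (hA : MeasurableSet A) (hB : MeasurableSet B)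
    (hBA : B ⊆ A) (hPA : 1 / 2 ≤ P.real A) (hPB : 1 / 2 ≤ P.real B)
    (hGA : ∀ i y u v, u ∈ A → v ∈ A → G (Function.update y i u) = G (Function.update y i v)) :
    ∫ ω, G (fun j => Y j ω) *
      (centredCount P B (fun j => Y j ω) - centredCount P A (fun j => Y j ω)) ∂μ = 0 := by
  have hPA0 : P.real A ≠ 0 := by linarith
  have hPB0 : P.real B ≠ 0 := by linarith
  obtain ⟨u₀, hu₀⟩ : A.Nonempty := by
    rw [Set.nonempty_iff_ne_empty]
    rintro rfl
    simp at hPA0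
  have hint : ∀ (S : Set ℝ), MeasurableSet S → 1 / 2 ≤ P.real S → ∀ i, Integrable
      (fun ω => G (fun j => Y j ω) * (S.indicator 1 (Y i ω) / P.real S)) μ := by
    intro S hS hPS i
    refine (integrable_comp_of_bound hm hG hc).mul_bdd (c := 2)
      (((measurable_one.indicator hS).comp (hm i)).div_const _).aestronglyMeasurable
      (ae_of_all _ fun ω => ?_)
    have := abs_le.1 (abs_indicator_div_sub_one_le hPS (Y i ω))
    rw [Real.norm_eq_abs, abs_le]
    constructor <;> linarith
  have h : ∀ ω, G (fun j => Y j ω) *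
      (centredCount P B (fun j => Y j ω) - centredCount P A (fun j => Y j ω))
      = ∑ i, (G (fun j => Y j ω) * (B.indicator 1 (Y i ω) / P.real B)
        - G (fun j => Y j ω) * (A.indicator 1 (Y i ω) / P.real A)) := by
    intro ω
    rw [centredCount, centredCount, ← Finset.sum_sub_distrib, Finset.mul_sum]
    exact Finset.sum_congr rfl fun i _ => by ring
  simp_rw [h]
  rw [integral_finsetSum _ fun i _ => by exact (hint B hB hPB i).sub (hint A hA hPA i)]
  refine Finset.sum_eq_zero fun i _ => ?_
  rw [integral_sub (hint B hB hPB i) (hint A hA hPA i),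
    integral_mul_indicator_div hm hl hi hG hB hBA hPB0 i (hGA i) hu₀,
    integral_mul_indicator_div hm hl hi hG hA le_rfl hPA0 i (hGA i) hu₀, sub_self]

/-- **Doob's maximal inequality** for `exp (θ * centredCount)` along a decreasing chain of sets. -/
theorem exp_mul_measureReal_le_setIntegral (hm : ∀ i, Measurable (Y i))
    (hl : ∀ i, HasLaw (Y i) P μ) (hi : iIndepFun Y μ) {B : ℕ → Set ℝ}
    (hB : ∀ k, MeasurableSet (B k)) (hanti : Antitone B) (hPB : ∀ k, 1 / 2 ≤ P.real (B k))
    (θ a : ℝ) (k : ℕ) :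
    Real.exp a * μ.real {ω | ∃ l ≤ k, a ≤ θ * centredCount P (B l) (fun j => Y j ω)}
      ≤ ∫ ω in {ω | ∃ l ≤ k, a ≤ θ * centredCount P (B l) (fun j => Y j ω)},
          Real.exp (θ * centredCount P (B k) (fun j => Y j ω)) ∂μ := by
  have hYm : Measurable fun ω j => Y j ω := measurable_pi_lambda _ hm
  have hTm : ∀ k, MeasurableSet
      {y : Fin n → ℝ | ∃ l ≤ k, a ≤ θ * centredCount P (B l) y} := by
    intro k
    have : {y : Fin n → ℝ | ∃ l ≤ k, a ≤ θ * centredCount P (B l) y}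
        = ⋃ l, ⋃ (_ : l ≤ k), {y | a ≤ θ * centredCount P (B l) y} := by
      ext y; simp
    rw [this]
    exact MeasurableSet.iUnion fun l => MeasurableSet.iUnion fun _ =>
      measurableSet_le measurable_const ((measurable_centredCount P (hB l) n).const_mul θ)
  have hexpm : ∀ k, Measurable fun y : Fin n → ℝ => Real.exp (θ * centredCount P (B k) y) :=
    fun k => ((measurable_centredCount P (hB k) n).const_mul θ).exp
  have hexp : ∀ k, Integrable
      (fun ω => Real.exp (θ * centredCount P (B k) (fun j => Y j ω))) μ := fun k =>
    integrable_comp_of_bound hm (hexpm k) (abs_exp_mul_centredCount_le θ (hPB k))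
  have hconst : ∀ (S : Set Ω) (k : ℕ), MeasurableSet S →
      (∀ ω ∈ S, a ≤ θ * centredCount P (B k) (fun j => Y j ω)) →
      Real.exp a * μ.real S
        ≤ ∫ ω in S, Real.exp (θ * centredCount P (B k) (fun j => Y j ω)) ∂μ := by
    intro S k hS h
    have := setIntegral_mono_on (integrable_const (Real.exp a)).integrableOn
      (hexp k).integrableOn hS fun ω hω => Real.exp_le_exp.2 (h ω hω)
    simpa [mul_comm] using this
  induction k with
  | zero =>
    refine hconst _ 0 (hYm (hTm 0)) ?_
    rintro ω ⟨l, hl0, h⟩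
    rwa [Nat.le_zero.1 hl0] at h
  | succ k ih =>
    set T : ℕ → Set Ω :=
      fun k => {ω | ∃ l ≤ k, a ≤ θ * centredCount P (B l) (fun j => Y j ω)} with hT
    -- `N` is the event that the level is first reached at time `k + 1`.
    set N : Set Ω := {ω | a ≤ θ * centredCount P (B (k + 1)) (fun j => Y j ω)} \ T k with hN
    have hTmeas : ∀ k, MeasurableSet (T k) := fun k => hYm (hTm k)
    have hNm : MeasurableSet N := (measurableSet_le measurable_const
      (((measurable_centredCount P (hB (k + 1)) n).comp hYm).const_mul θ)).diff (hTmeas k)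
    have hTN : T (k + 1) = T k ∪ N := by
      ext ω
      simp only [hT, hN, Set.mem_ofPred_eq, Set.mem_union, Set.mem_sdiff]
      constructor
      · rintro ⟨l, hlk, h⟩
        by_cases hex : ∃ l ≤ k, a ≤ θ * centredCount P (B l) (fun j => Y j ω)
        · exact Or.inl hex
        · rcases Nat.le_succ_iff.1 hlk with hlk | rfl
          · exact (hex ⟨l, hlk, h⟩).elim
          · exact Or.inr ⟨h, hex⟩
      · rintro (⟨l, hlk, h⟩ | ⟨h, -⟩)
        · exact ⟨l, hlk.trans k.le_succ, h⟩
        · exact ⟨k + 1, le_rfl, h⟩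
    have hdisj : Disjoint (T k) N := Set.disjoint_sdiff_right
    change Real.exp a * μ.real (T (k + 1)) ≤ ∫ ω in T (k + 1), _ ∂μ
    rw [hTN, setIntegral_union hdisj hNm (hexp _).integrableOn (hexp _).integrableOn,
      measureReal_union hdisj hNm, mul_add]
    refine add_le_add (ih.trans ?_) (hconst N (k + 1) hNm fun ω hω => hω.1)
    -- The exponential at time `k`, cut off to `T k`, depends only on the past, so it is orthogonal
    -- to the next increment.
    let G : (Fin n → ℝ) → ℝ :=
      {y | ∃ l ≤ k, a ≤ θ * centredCount P (B l) y}.indicator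
        fun y => Real.exp (θ * centredCount P (B k) y)
    have hGm : Measurable G := (hexpm k).indicator (hTm k)
    have hGb : ∀ y, |G y| ≤ Real.exp (|θ| * n) := fun y =>
      (norm_indicator_le_norm_self
        (fun y => Real.exp (θ * centredCount P (B k) y)) y).trans
        (abs_exp_mul_centredCount_le θ (hPB k) y)
    have hGA : ∀ i y u v, u ∈ B k → v ∈ B k →
        G (Function.update y i u) = G (Function.update y i v) := by
      intro i y u v hu hv
      have h : ∀ l ≤ k, centredCount P (B l) (Function.update y i u)
          = centredCount P (B l) (Function.update y i v) := fun l hlk =>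
        centredCount_update P (hanti hlk) y i hu hv
      have hiff : (∃ l ≤ k, a ≤ θ * centredCount P (B l) (Function.update y i u))
          ↔ ∃ l ≤ k, a ≤ θ * centredCount P (B l) (Function.update y i v) :=
        exists_congr fun l => and_congr_right fun hlk => by rw [h l hlk]
      simp only [G, Set.indicator_apply, Set.mem_ofPred_eq, hiff, h k le_rfl]
    have hzero := integral_mul_centredCount_sub_eq_zero hm hl hi hGm hGb (hB k) (hB (k + 1))
      (hanti k.le_succ) (hPB k) (hPB (k + 1)) hGA
    have hGint : Integrable (fun ω => G (fun j => Y j ω) *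
        (centredCount P (B (k + 1)) (fun j => Y j ω)
          - centredCount P (B k) (fun j => Y j ω))) μ := by
      refine (integrable_comp_of_bound hm hGm hGb).mul_bdd (c := n + n)
        (((measurable_centredCount P (hB (k + 1)) n).comp hYm).sub
          ((measurable_centredCount P (hB k) n).comp hYm)).aestronglyMeasurable
        (ae_of_all _ fun ω => ?_)
      exact (abs_sub _ _).trans
        (add_le_add (abs_centredCount_le (hPB _) _) (abs_centredCount_le (hPB _) _))
    rw [← integral_indicator (hTmeas k), ← integral_indicator (hTmeas k)]
    -- Adding a term of zero integral reduces the comparison to the pointwise bound `exp x ≥ 1 + x`.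
    have hlow : ∫ ω, (T k).indicator
          (fun ω => Real.exp (θ * centredCount P (B k) (fun j => Y j ω))) ω ∂μ
        = ∫ ω, ((T k).indicator
          (fun ω => Real.exp (θ * centredCount P (B k) (fun j => Y j ω))) ω
          + θ * (G (fun j => Y j ω) * (centredCount P (B (k + 1)) (fun j => Y j ω)
          - centredCount P (B k) (fun j => Y j ω)))) ∂μ := by
      rw [integral_add ((hexp k).indicator (hTmeas k)) (hGint.const_mul θ), integral_const_mul,
        hzero, mul_zero, add_zero]
    rw [hlow]
    refine integral_mono (((hexp k).indicator (hTmeas k)).add (hGint.const_mul θ))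
      ((hexp (k + 1)).indicator (hTmeas k)) fun ω => ?_
    by_cases hω : ω ∈ T k
    · have hG1 : G (fun j => Y j ω) = Real.exp (θ * centredCount P (B k) (fun j => Y j ω)) :=
        Set.indicator_of_mem (s := {y | ∃ l ≤ k, a ≤ θ * centredCount P (B l) y}) hω _
      simp only [Set.indicator_of_mem hω, hG1]
      set p := centredCount P (B k) (fun j => Y j ω)
      set q := centredCount P (B (k + 1)) (fun j => Y j ω)
      have e : Real.exp (θ * q) = Real.exp (θ * p) * Real.exp (θ * (q - p)) := by
        rw [← Real.exp_add]; ring_nf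
      rw [e]
      nlinarith [Real.add_one_le_exp (θ * (q - p)), Real.exp_pos (θ * p)]
    · have hG1 : G (fun j => Y j ω) = 0 :=
        Set.indicator_of_notMem (s := {y | ∃ l ≤ k, a ≤ θ * centredCount P (B l) y}) hω _
      simp [Set.indicator_of_notMem hω, hG1]

variable [IsProbabilityMeasure P]

/-- Hoeffding's lemma on `[-1, 1]` makes each centred summand sub-Gaussian with parameter 1;
independence adds the parameters. -/
theorem integral_exp_mul_centredCount_le (hm : ∀ i, Measurable (Y i))
    (hl : ∀ i, HasLaw (Y i) P μ) (hi : iIndepFun Y μ) {B : Set ℝ}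
    (hB : MeasurableSet B) (hPB : 1 / 2 ≤ P.real B) (θ : ℝ) :
    ∫ ω, Real.exp (θ * centredCount P B (fun j => Y j ω)) ∂μ ≤ Real.exp (n * θ ^ 2 / 2) := by
  let φ : ℝ → ℝ := fun u => B.indicator 1 u / P.real B - 1
  have hφ : Measurable φ := ((measurable_one.indicator hB).div_const _).sub_const _
  have hφi : Integrable φ P := Integrable.of_bound hφ.aestronglyMeasurable 1
    (ae_of_all _ fun u => abs_indicator_div_sub_one_le hPB u)
  have hmean : ∀ i, ∫ ω, φ (Y i ω) ∂μ = 0 := by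
    intro i
    refine ((hl i).integral_comp (f := φ) hφ.aestronglyMeasurable).trans ?_
    have : Integrable (fun u => B.indicator (1 : ℝ → ℝ) u / P.real B) P := by
      refine (hφi.add (integrable_const (1 : ℝ))).congr (ae_of_all _ fun u => ?_)
      simp [φ]
    simp only [φ]
    rw [integral_sub this (integrable_const _), integral_div, integral_indicator_one hB,
      div_self (by linarith)]
    simp
  have hsub : ∀ i, HasSubgaussianMGF (fun ω => φ (Y i ω)) 1 μ := by
    intro i
    have := hasSubgaussianMGF_of_mem_Icc_of_integral_eq_zero (a := -1) (b := 1)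
      (hφ.comp (hm i)).aemeasurable
      (ae_of_all μ fun ω => abs_le.1 (abs_indicator_div_sub_one_le hPB (Y i ω))) (hmean i)
    have h : ‖(1 : ℝ) - -1‖₊ = 2 := by
      ext; norm_num
    rwa [h, div_self two_ne_zero, one_pow] at this
  have hsum := HasSubgaussianMGF.sum_of_iIndepFun (hi.comp (fun _ => φ) fun _ => hφ)
    (s := Finset.univ) fun i _ => hsub i
  have := hsum.mgf_le θ
  simpa [mgf, φ, centredCount] using this

/-- Doob's inequality at `θ = ε`, the optimal Chernoff parameter for a deviation of size `n * |ε|`.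
The sign of `ε` is free, so both tails are covered. -/
theorem measure_exists_le_mul_centredCount (hm : ∀ i, Measurable (Y i))
    (hl : ∀ i, HasLaw (Y i) P μ) (hi : iIndepFun Y μ) {B : ℕ → Set ℝ}
    (hB : ∀ k, MeasurableSet (B k)) (hanti : Antitone B) (hPB : ∀ k, 1 / 2 ≤ P.real (B k))
    (ε : ℝ) (k : ℕ) :
    μ.real {ω | ∃ l ≤ k, n * ε ^ 2 ≤ ε * centredCount P (B l) (fun j => Y j ω)}
      ≤ Real.exp (-(n * ε ^ 2 / 2)) := by
  have h1 := exp_mul_measureReal_le_setIntegral hm hl hi hB hanti hPB ε (n * ε ^ 2) k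
  have h2 := setIntegral_le_integral (μ := μ)
    (s := {ω | ∃ l ≤ k, n * ε ^ 2 ≤ ε * centredCount P (B l) (fun j => Y j ω)})
    (integrable_comp_of_bound hm ((measurable_centredCount P (hB k) n).const_mul ε).exp
      (abs_exp_mul_centredCount_le ε (hPB k))) (ae_of_all _ fun ω => (Real.exp_pos _).le)
  have h3 := integral_exp_mul_centredCount_le hm hl hi (hB k) (hPB k) ε
  have h4 := (h1.trans h2).trans h3
  have h5 : Real.exp (n * ε ^ 2 / 2)
      = Real.exp (n * ε ^ 2) * Real.exp (-(n * ε ^ 2 / 2)) := by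
    rw [← Real.exp_add]; ring_nf
  rw [h5] at h4
  exact le_of_mul_le_mul_left h4 (Real.exp_pos _)

end Martingale

/-! ### Empirical measure and half-lines -/

/-- The empirical measure `(1/n) ∑ᵢ δ_{yᵢ}`. -/
noncomputable def empMeasure {n : ℕ} (y : Fin n → ℝ) : Measure ℝ :=
  (n : ENNReal)⁻¹ • ∑ i, Measure.dirac (y i)

theorem isProbabilityMeasure_empMeasure {n : ℕ} (hn : 0 < n) (y : Fin n → ℝ) :
    IsProbabilityMeasure (empMeasure y) := by
  refine ⟨?_⟩
  simp only [empMeasure, Measure.smul_apply, Measure.finsetSum_apply, measure_univ]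
  simp [ENNReal.inv_mul_cancel, hn.ne']

theorem integral_empMeasure {n : ℕ} (y : Fin n → ℝ) (g : ℝ → ℝ) :
    ∫ u, g u ∂(empMeasure y) = (1 / (n : ℝ)) * ∑ i, g (y i) := by
  rw [empMeasure, integral_smul_measure,
    integral_finsetSum_measure fun i _ => integrable_dirac (by simp)]
  simp

theorem empCDF_eq_cdf {n : ℕ} (hn : 0 < n) (y : Fin n → ℝ) (t : ℝ) :
    empCDF y t = cdf (empMeasure y) t := by
  have := isProbabilityMeasure_empMeasure hn y
  rw [cdf_eq_real, ← integral_indicator_one measurableSet_Iic, integral_empMeasure, empCDF]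
  simp [Set.indicator_apply]

theorem centredCount_Iic {P : Measure ℝ} [IsProbabilityMeasure P] {n : ℕ} (hn : 0 < n)
    (y : Fin n → ℝ) {t : ℝ} (ht : cdf P t ≠ 0) :
    centredCount P (Set.Iic t) y * cdf P t = n * (empCDF y t - cdf P t) := by
  have hn' : (n : ℝ) ≠ 0 := by positivity
  rw [centredCount, empCDF, Finset.sum_sub_distrib, ← Finset.sum_div, ← cdf_eq_real]
  simp only [Set.indicator_apply, Set.mem_Iic, Pi.one_apply, Finset.sum_const, Finset.card_univ,
    Fintype.card_fin, nsmul_eq_mul]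
  field_simp

theorem measureReal_Ioi_eq (P : Measure ℝ) [IsProbabilityMeasure P] (t : ℝ) :
    P.real (Set.Ioi t) = 1 - cdf P t := by
  rw [cdf_eq_real, ← Set.compl_Iic, probReal_compl_eq_one_sub measurableSet_Iic]

theorem centredCount_Ioi {P : Measure ℝ} [IsProbabilityMeasure P] {n : ℕ} (hn : 0 < n)
    (y : Fin n → ℝ) {t : ℝ} (ht : 1 - cdf P t ≠ 0) :
    centredCount P (Set.Ioi t) y * (1 - cdf P t) = -(n * (empCDF y t - cdf P t)) := by
  have hn' : (n : ℝ) ≠ 0 := by positivity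
  have h : ∑ i, (Set.Ioi t).indicator (1 : ℝ → ℝ) (y i)
      = n - ∑ i, if y i ≤ t then (1 : ℝ) else 0 := by
    have : (n : ℝ) = ∑ _i : Fin n, (1 : ℝ) := by simp
    rw [this, ← Finset.sum_sub_distrib]
    refine Finset.sum_congr rfl fun i _ => ?_
    by_cases h : y i ≤ t
    · simp [h]
    · simp [h, not_le.1 h]
  rw [centredCount, empCDF, Finset.sum_sub_distrib, ← Finset.sum_div, measureReal_Ioi_eq, h]
  simp only [Finset.sum_const, Finset.card_univ, Fintype.card_fin, nsmul_eq_mul]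
  field_simp
  ring

theorem exists_monotone_enumeration {α : Type*} [LinearOrder α] {S : Finset α}
    (hS : S.Nonempty) : ∃ (t : ℕ → α) (k : ℕ), Monotone t ∧ (∀ l, t l ∈ S) ∧
      ∀ s ∈ S, ∃ l ≤ k, t l = s := by
  obtain ⟨k, hk⟩ : ∃ k, S.card = k + 1 := Nat.exists_eq_succ_of_ne_zero hS.card_pos.ne'
  -- The enumeration stays at its last value after index `k`, so it is defined on all of `ℕ`.
  refine ⟨fun l => S.orderEmbOfFin hk ⟨min l k, by omega⟩, k, ?_, ?_, ?_⟩
  · intro a b hab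
    exact (S.orderEmbOfFin hk).monotone (by simp only [Fin.mk_le_mk]; omega)
  · exact fun l => S.orderEmbOfFin_mem hk _
  · intro s hs
    rw [← Finset.mem_coe, ← S.range_orderEmbOfFin hk] at hs
    obtain ⟨⟨l, hl⟩, rfl⟩ := hs
    refine ⟨l, by omega, ?_⟩
    simp only [min_eq_left (Nat.lt_succ_iff.1 hl)]

/-! ### Uniform deviation of the empirical distribution function -/

section DKW

variable {Ω : Type*} [MeasurableSpace Ω] {μ : Measure Ω} [IsProbabilityMeasure μ]
  {P : Measure ℝ} [IsProbabilityMeasure P] {n : ℕ} {Y : Fin n → Ω → ℝ}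

theorem measure_exists_mem_le_mul_centredCount (hm : ∀ i, Measurable (Y i))
    (hl : ∀ i, HasLaw (Y i) P μ) (hi : iIndepFun Y μ) {ι : Type*} [LinearOrder ι]
    {B : ι → Set ℝ} (hB : ∀ s, MeasurableSet (B s)) (hanti : Antitone B) {S : Finset ι}
    (hPB : ∀ s ∈ S, 1 / 2 ≤ P.real (B s)) (ε : ℝ) :
    μ.real {ω | ∃ s ∈ S, n * ε ^ 2 ≤ ε * centredCount P (B s) (fun j => Y j ω)}
      ≤ Real.exp (-(n * ε ^ 2 / 2)) := by
  rcases S.eq_empty_or_nonempty with rfl | hS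
  · simp [Real.exp_nonneg]
  obtain ⟨t, k, htm, htS, hSt⟩ := exists_monotone_enumeration hS
  refine (measureReal_mono ?_).trans (measure_exists_le_mul_centredCount hm hl hi
    (B := fun l => B (t l)) (fun l => hB _) (fun a b hab => hanti (htm hab))
    (fun l => hPB _ (htS l)) ε k)
  rintro ω ⟨s, hs, h⟩
  obtain ⟨l, hlk, rfl⟩ := hSt s hs
  exact ⟨l, hlk, h⟩

/-- Splitting at the median keeps the relevant half-line of mass at least `1/2`. Two chains and two
signs account for the factor 4. -/
theorem measureReal_exists_mem_abs_empCDF_sub_cdf_ge (hm : ∀ i, Measurable (Y i))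
    (hl : ∀ i, HasLaw (Y i) P μ) (hi : iIndepFun Y μ) (hn : 0 < n) {ε : ℝ} (hε : 0 ≤ ε)
    (S : Finset ℝ) :
    μ.real {ω | ∃ t ∈ S, ε ≤ |empCDF (fun j => Y j ω) t - cdf P t|}
      ≤ 4 * Real.exp (-(n * ε ^ 2 / 2)) := by
  classical
  let S₁ : Finset ℝ := S.filter fun t => cdf P t ≤ 1 / 2
  -- The reversed order makes `Iic` a decreasing chain.
  let S₂ : Finset ℝᵒᵈ := (S.filter fun t => 1 / 2 ≤ cdf P t).map OrderDual.toDual.toEmbedding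
  have h₁ := fun ε => measure_exists_mem_le_mul_centredCount hm hl hi (B := Set.Ioi) (S := S₁)
    (fun _ => measurableSet_Ioi) (fun a b hab => Set.Ioi_subset_Ioi hab)
    (fun s hs => by
      rw [measureReal_Ioi_eq]
      linarith [(Finset.mem_filter.1 hs).2]) ε
  have h₂ := fun ε => measure_exists_mem_le_mul_centredCount hm hl hi
    (B := fun s : ℝᵒᵈ => Set.Iic (OrderDual.ofDual s)) (S := S₂)
    (fun _ => measurableSet_Iic) (fun a b hab => Set.Iic_subset_Iic.2 hab)
    (fun s hs => by
      rw [← cdf_eq_real]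
      obtain ⟨t, ht, rfl⟩ := Finset.mem_map.1 hs
      exact (Finset.mem_filter.1 ht).2) ε
  -- The deviation is `d = p * X / n` with `p ≤ 1`, so `|X|` is at least `n * |d|`.
  have key : ∀ X p d : ℝ, 0 < p → p ≤ 1 → X * p = n * d → ε ≤ |d| →
      n * ε ^ 2 ≤ ε * X ∨ n * (-ε) ^ 2 ≤ (-ε) * X := by
    intro X p d hp hp1 hX hd
    have hX' : n * ε ≤ |X| := by
      have h1 : |X| * p = n * |d| := by
        rw [← abs_of_pos hp, ← abs_mul, hX, abs_mul, Nat.abs_cast]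
      have h2 : |X| * p ≤ |X| := mul_le_of_le_one_right (abs_nonneg X) hp1
      have h3 : (n : ℝ) * ε ≤ n * |d| := by gcongr
      linarith
    rcases le_abs'.1 hX' with h | h
    · right; nlinarith
    · left; nlinarith
  have hsub : {ω | ∃ t ∈ S, ε ≤ |empCDF (fun j => Y j ω) t - cdf P t|} ⊆
      ({ω | ∃ s ∈ S₁, n * ε ^ 2 ≤ ε * centredCount P (Set.Ioi s) (fun j => Y j ω)} ∪
       {ω | ∃ s ∈ S₁, n * (-ε) ^ 2 ≤ (-ε) * centredCount P (Set.Ioi s) (fun j => Y j ω)}) ∪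
      ({ω | ∃ s ∈ S₂, n * ε ^ 2 ≤
          ε * centredCount P (Set.Iic (OrderDual.ofDual s)) (fun j => Y j ω)} ∪
       {ω | ∃ s ∈ S₂, n * (-ε) ^ 2 ≤
          (-ε) * centredCount P (Set.Iic (OrderDual.ofDual s)) (fun j => Y j ω)}) := by
    rintro ω ⟨t, htS, ht⟩
    rcases le_total (cdf P t) (1 / 2) with h | h
    · left
      have hmem : t ∈ S₁ := Finset.mem_filter.2 ⟨htS, h⟩
      have hX := centredCount_Ioi (P := P) hn (fun j => Y j ω) (t := t) (by linarith)
      rw [← mul_neg] at hX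
      rcases key _ _ _ (by linarith) (by linarith [cdf_nonneg P t]) hX (by rwa [abs_neg])
        with h | h
      · exact Or.inl ⟨t, hmem, h⟩
      · exact Or.inr ⟨t, hmem, h⟩
    · right
      have hmem : OrderDual.toDual t ∈ S₂ :=
        Finset.mem_map.2 ⟨t, Finset.mem_filter.2 ⟨htS, h⟩, rfl⟩
      have hX := centredCount_Iic (P := P) hn (fun j => Y j ω) (t := t) (by linarith)
      rcases key _ _ _ (by linarith) (cdf_le_one P t) hX ht with h | h
      · exact Or.inl ⟨_, hmem, h⟩
      · exact Or.inr ⟨_, hmem, h⟩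
  have h₁' := h₁ (-ε)
  have h₂' := h₂ (-ε)
  have hexp : (-ε) ^ 2 = ε ^ 2 := neg_sq ε
  have e := ((measureReal_mono (μ := μ) hsub).trans (measureReal_union_le _ _)).trans
    (add_le_add (measureReal_union_le _ _) (measureReal_union_le _ _))
  have := h₁ ε
  have := h₂ ε
  rw [hexp] at h₁' h₂' e
  linarith

/-- The finite bound does not depend on `S`, so it survives the directed union over finite sets of
rationals. -/
theorem measure_exists_rat_abs_empCDF_sub_cdf_ge (hm : ∀ i, Measurable (Y i))
    (hl : ∀ i, HasLaw (Y i) P μ) (hi : iIndepFun Y μ) (hn : 0 < n) {ε : ℝ} (hε : 0 ≤ ε) :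
    μ {ω | ∃ q : ℚ, ε ≤ |empCDF (fun j => Y j ω) q - cdf P q|}
      ≤ ENNReal.ofReal (4 * Real.exp (-(n * ε ^ 2 / 2))) := by
  classical
  let E : Finset ℚ → Set Ω := fun S =>
    {ω | ∃ q ∈ S, ε ≤ |empCDF (fun j => Y j ω) (q : ℝ) - cdf P q|}
  have hE : {ω | ∃ q : ℚ, ε ≤ |empCDF (fun j => Y j ω) q - cdf P q|} = ⋃ S, E S := by
    ext ω
    simp only [E, Set.mem_iUnion, Set.mem_ofPred_eq]
    exact ⟨fun ⟨q, hq⟩ => ⟨{q}, q, Finset.mem_singleton_self q, hq⟩,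
      fun ⟨S, q, _, hq⟩ => ⟨q, hq⟩⟩
  have hmono : Monotone E := fun S T hST ω ⟨q, hq, h⟩ => ⟨q, hST hq, h⟩
  rw [hE, hmono.directed_le.measure_iUnion]
  refine iSup_le fun S => ?_
  rw [← ofReal_measureReal]
  refine ENNReal.ofReal_le_ofReal ((measureReal_mono ?_).trans
    (measureReal_exists_mem_abs_empCDF_sub_cdf_ge hm hl hi hn hε (S.image fun q : ℚ => (q : ℝ))))
  rintro ω ⟨q, hq, h⟩
  exact ⟨q, Finset.mem_image_of_mem _ hq, h⟩

theorem abs_cdf_sub_le_of_forall_rat (P Q : Measure ℝ) {ε : ℝ}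
    (h : ∀ q : ℚ, |cdf Q q - cdf P q| ≤ ε) (t : ℝ) : |cdf Q t - cdf P t| ≤ ε := by
  by_contra! hlt
  have hc : ContinuousWithinAt (fun u => |cdf Q u - cdf P u|) (Set.Ioi t) t :=
    ((((cdf Q).right_continuous t).sub ((cdf P).right_continuous t)).abs).mono
      Set.Ioi_subset_Ici_self
  obtain ⟨u, htu, hu⟩ := mem_nhdsGT_iff_exists_Ioo_subset.1
    (hc.eventually (lt_mem_nhds hlt))
  obtain ⟨q, hq1, hq2⟩ := exists_rat_btwn (show t < u from htu)
  exact absurd (h q) (not_le.2 (hu ⟨hq1, hq2⟩))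

/-- A **Dvoretzky–Kiefer–Wolfowitz** inequality (with non-optimal constants). -/
theorem dvoretzky_kiefer_wolfowitz (hm : ∀ i, Measurable (Y i))
    (hl : ∀ i, HasLaw (Y i) P μ) (hi : iIndepFun Y μ) (hn : 0 < n) {ε : ℝ} (hε : 0 ≤ ε) :
    ENNReal.ofReal (1 - 4 * Real.exp (-(n * ε ^ 2 / 2)))
      ≤ μ {ω | ∀ t, |empCDF (fun j => Y j ω) t - cdf P t| ≤ ε} := by
  set E : Set Ω := {ω | ∃ q : ℚ, ε ≤ |empCDF (fun j => Y j ω) q - cdf P q|} with hE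
  have h1 : Eᶜ ⊆ {ω | ∀ t, |empCDF (fun j => Y j ω) t - cdf P t| ≤ ε} := by
    intro ω hω t
    simp only [hE, Set.mem_compl_iff, Set.mem_ofPred_eq, not_exists, not_le] at hω
    simp only [empCDF_eq_cdf hn] at hω ⊢
    exact abs_cdf_sub_le_of_forall_rat _ _ (fun q => (hω q).le) t
  have h2 : (1 : ENNReal) ≤ μ E + μ Eᶜ := by
    rw [← measure_univ (μ := μ)]; exact measure_univ_le_add_compl E
  have h3 := measure_exists_rat_abs_empCDF_sub_cdf_ge hm hl hi hn hε
  rw [ENNReal.ofReal_sub _ (by positivity), ENNReal.ofReal_one]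
  refine (tsub_le_iff_left.2 ?_).trans (measure_mono h1)
  exact h2.trans (add_le_add_left h3 _)

end DKW

/-! ### Kolmogorov distance and integrals of monotone functions -/

section Deterministic

variable {P Q : Measure ℝ} [IsProbabilityMeasure P] [IsProbabilityMeasure Q] {ε : ℝ}

theorem measureReal_Iio_eq (P : Measure ℝ) [IsProbabilityMeasure P] (c : ℝ) :
    P.real (Set.Iio c) = Function.leftLim (cdf P) c := by
  have h := (cdf P).measure_Iio (tendsto_cdf_atBot P) c
  rw [measure_cdf, sub_zero] at h
  rw [measureReal_def, h, ENNReal.toReal_ofReal]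
  exact (cdf_nonneg P (c - 1)).trans ((monotone_cdf P).le_leftLim (sub_one_lt c))

/-- An upper set is empty, everything, or a half-line `Ioi` or `Ici`. The closed half-line follows
from the bound on left limits. -/
theorem abs_measureReal_sub_le_of_isUpperSet (h : ∀ t, |cdf Q t - cdf P t| ≤ ε) {U : Set ℝ}
    (hU : IsUpperSet U) : |Q.real U - P.real U| ≤ ε := by
  have hε : 0 ≤ ε := (abs_nonneg _).trans (h 0)
  rcases U.eq_empty_or_nonempty with rfl | hne
  · simpa
  by_cases hbdd : BddBelow U
  swap
  · have : U = Set.univ := by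
      refine Set.eq_univ_of_forall fun x => ?_
      obtain ⟨u, hu, hux⟩ := not_bddBelow_iff.1 hbdd x
      exact hU hux.le hu
    simpa [this]
  by_cases hmem : sInf U ∈ U
  · have hUeq : U = Set.Ici (sInf U) :=
      Set.Subset.antisymm (fun u hu => csInf_le hbdd hu) (fun u hu => hU hu hmem)
    have hcompl : ∀ (ν : Measure ℝ) [IsProbabilityMeasure ν],
        ν.real U = 1 - Function.leftLim (cdf ν) (sInf U) := by
      intro ν _
      rw [← measureReal_Iio_eq, ← probReal_compl_eq_one_sub measurableSet_Iio, Set.compl_Iio,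
        ← hUeq]
    rw [hcompl Q, hcompl P]
    have hlim := (((monotone_cdf Q).tendsto_leftLim (sInf U)).sub
      ((monotone_cdf P).tendsto_leftLim (sInf U))).abs
    have := le_of_tendsto hlim (Filter.Eventually.of_forall h)
    rwa [sub_sub_sub_cancel_left, abs_sub_comm]
  · have hUeq : U = Set.Ioi (sInf U) := by
      refine Set.Subset.antisymm (fun u hu => ?_) (fun u hu => ?_)
      · exact lt_of_le_of_ne (csInf_le hbdd hu) fun e => hmem (e ▸ hu)
      · obtain ⟨v, hv, hvu⟩ := exists_lt_of_csInf_lt hne hu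
        exact hU hvu.le hv
    rw [hUeq, measureReal_Ioi_eq, measureReal_Ioi_eq, ← abs_neg]
    convert h (sInf U) using 2
    ring

theorem integrable_of_monotone_of_mem_Icc (P : Measure ℝ) [IsProbabilityMeasure P] {g : ℝ → ℝ}
    (hg : Monotone g) {a b : ℝ} (hab : ∀ u, g u ∈ Set.Icc a b) : Integrable g P :=
  Integrable.of_mem_Icc a b hg.measurable.aemeasurable (ae_of_all _ hab)

/-- Integrals of a bounded monotone function are controlled by the Kolmogorov distance. -/
theorem abs_integral_sub_le_of_monotone (h : ∀ t, |cdf Q t - cdf P t| ≤ ε) {g : ℝ → ℝ}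
    (hg : Monotone g) {a b : ℝ} (hab : ∀ u, g u ∈ Set.Icc a b) :
    |∫ u, g u ∂Q - ∫ u, g u ∂P| ≤ ε * (b - a) := by
  have hab0 : a ≤ b := (hab 0).1.trans (hab 0).2
  have hlayer : ∀ (ν : Measure ℝ) [IsProbabilityMeasure ν],
      ∫ u, g u ∂ν = a + ∫ t in Set.Ioc 0 (b - a), ν.real {u | t ≤ g u - a} := by
    intro ν _
    have hgi := integrable_of_monotone_of_mem_Icc ν hg hab
    rw [← Integrable.integral_eq_integral_Ioc_meas_le (f := fun u => g u - a) (M := b - a)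
      (hgi.sub (integrable_const a)) (ae_of_all _ fun u => sub_nonneg.2 (hab u).1)
      (ae_of_all _ fun u => sub_le_sub_right (hab u).2 a), integral_sub hgi (integrable_const a)]
    simp
  have hint : ∀ (ν : Measure ℝ) [IsProbabilityMeasure ν],
      IntegrableOn (fun t => ν.real {u | t ≤ g u - a}) (Set.Ioc 0 (b - a)) := by
    intro ν _
    have hanti : Antitone fun t => ν.real {u | t ≤ g u - a} := fun s t hst =>
      measureReal_mono fun u hu => hst.trans hu
    refine Measure.integrableOn_of_bounded (M := 1) (by simp)
      hanti.measurable.aestronglyMeasurable (ae_of_all _ fun t => ?_)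
    rw [Real.norm_of_nonneg measureReal_nonneg]
    exact measureReal_le_one
  rw [hlayer Q, hlayer P, add_sub_add_left_eq_sub, ← integral_sub (hint Q) (hint P)]
  rw [← Real.norm_eq_abs]
  refine (norm_setIntegral_le_of_norm_le_const (C := ε) measure_Ioc_lt_top
    fun t _ => ?_).trans_eq ?_
  · refine abs_measureReal_sub_le_of_isUpperSet h fun u v huv hu => ?_
    exact (show t ≤ g u - a from hu).trans (sub_le_sub_right (hg huv) a)
  · rw [Real.volume_real_Ioc_of_le (by linarith), sub_zero]

/-- If `f` and `g` are monotone, `|f - g| = 2 max f g - f - g` is a combination of monotone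
functions. -/
theorem abs_integral_abs_sub_sub_le (h : ∀ t, |cdf Q t - cdf P t| ≤ ε) {f g : ℝ → ℝ}
    (hf : Monotone f) (hg : Monotone g) {a b : ℝ} (hfab : ∀ u, f u ∈ Set.Icc a b)
    (hgab : ∀ u, g u ∈ Set.Icc a b) :
    |∫ u, |f u - g u| ∂Q - ∫ u, |f u - g u| ∂P| ≤ 4 * (ε * (b - a)) := by
  have hmab : ∀ u, max (f u) (g u) ∈ Set.Icc a b := fun u =>
    ⟨(hfab u).1.trans (le_max_left _ _), max_le (hfab u).2 (hgab u).2⟩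
  have hm : Monotone fun u => max (f u) (g u) := hf.max hg
  have hpt : ∀ u, |f u - g u| = 2 * max (f u) (g u) - f u - g u := by
    intro u
    rcases le_total (f u) (g u) with h | h
    · rw [abs_of_nonpos (by linarith), max_eq_right h]; ring
    · rw [abs_of_nonneg (by linarith), max_eq_left h]; ring
  have hI : ∀ (ν : Measure ℝ) [IsProbabilityMeasure ν],
      ∫ u, |f u - g u| ∂ν = 2 * ∫ u, max (f u) (g u) ∂ν - ∫ u, f u ∂ν - ∫ u, g u ∂ν := by
    intro ν _
    have h1 := integrable_of_monotone_of_mem_Icc ν hm hmab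
    have h2 := integrable_of_monotone_of_mem_Icc ν hf hfab
    have h3 := integrable_of_monotone_of_mem_Icc ν hg hgab
    simp_rw [hpt]
    rw [integral_sub (by exact (h1.const_mul 2).sub h2) h3, integral_sub (h1.const_mul 2) h2,
      integral_const_mul]
  have h1 := abs_le.1 (abs_integral_sub_le_of_monotone h hm hmab)
  have h2 := abs_le.1 (abs_integral_sub_le_of_monotone h hf hfab)
  have h3 := abs_le.1 (abs_integral_sub_le_of_monotone h hg hgab)
  rw [hI Q, hI P, abs_le]
  constructor <;> linarith

/-- Changing the measure costs `4 * 7L * ε = 28Lε`; replacing `cdf P` by `empCDF y` inside the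
integrand costs `2|w₁ - w₂|ε ≤ 4Lε`. -/
theorem abs_Err_sub_ErrHat_le {L : ℝ} (hP : ∀ᵐ y ∂P, y ∈ Set.Icc (-L) L) {n : ℕ} (hn : 0 < n)
    {y : Fin n → ℝ} (hy : ∀ i, y i ∈ Set.Icc (-L) L) (h : ∀ t, |empCDF y t - cdf P t| ≤ ε)
    {w₁ w₂ : ℝ} (hw₁ : w₁ ∈ Set.Icc (-L) L) (hw₂ : w₂ ∈ Set.Icc (-L) L) :
    |Err P w₁ w₂ - ErrHat y w₁ w₂| ≤ 32 * L * ε := by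
  have := isProbabilityMeasure_empMeasure hn y
  obtain ⟨hw₁l, hw₁u⟩ := hw₁
  obtain ⟨hw₂l, hw₂u⟩ := hw₂
  have hL : -L ≤ L := hw₁l.trans hw₁u
  -- Clamping keeps `f` bounded on the whole line without changing it on `[-L, L]`.
  let c : ℝ → ℝ := fun u => max (-L) (min L u)
  have hc : ∀ u ∈ Set.Icc (-L) L, c u = u := fun u hu => by
    simp [c, hu.1, hu.2]
  have hcm : Monotone c := fun u v huv => max_le_max le_rfl (min_le_min le_rfl huv)
  have hcI : ∀ u, c u ∈ Set.Icc (-L) L := fun u =>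
    ⟨le_max_left _ _, max_le hL (min_le_left _ _)⟩
  -- Adding `2L * cdf P` to both parts makes the coefficients of `cdf P` nonnegative and cancels in
  -- `f - g`.
  let f : ℝ → ℝ := fun u => c u - 2 * w₂ + (2 * w₂ + 2 * L) * cdf P u
  let g : ℝ → ℝ := fun u => (2 * w₁ + 2 * L) * cdf P u
  have hF := monotone_cdf P
  have hf : Monotone f := fun u v huv => by
    have := mul_le_mul_of_nonneg_left (hF huv) (show 0 ≤ 2 * w₂ + 2 * L by linarith)
    have := hcm huv
    simp only [f]
    linarith
  have hg : Monotone g := fun u v huv =>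
    mul_le_mul_of_nonneg_left (hF huv) (by linarith)
  have hfI : ∀ u, f u ∈ Set.Icc (-(3 * L)) (4 * L) := fun u => by
    have h0 := mul_nonneg (show 0 ≤ 2 * w₂ + 2 * L by linarith) (cdf_nonneg P u)
    have h1 := mul_le_mul_of_nonneg_left (cdf_le_one P u)
      (show 0 ≤ 2 * w₂ + 2 * L by linarith)
    have := hcI u
    constructor <;> simp only [f] <;> linarith [this.1, this.2]
  have hgI : ∀ u, g u ∈ Set.Icc (-(3 * L)) (4 * L) := fun u => by
    have h0 := mul_nonneg (show 0 ≤ 2 * w₁ + 2 * L by linarith) (cdf_nonneg P u)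
    have h1 := mul_le_mul_of_nonneg_left (cdf_le_one P u)
      (show 0 ≤ 2 * w₁ + 2 * L by linarith)
    constructor <;> simp only [g] <;> linarith
  have hfg : ∀ u ∈ Set.Icc (-L) L,
      f u - g u = u - 2 * w₁ * cdf P u - 2 * w₂ * (1 - cdf P u) := fun u hu => by
    simp only [f, g, hc u hu]; ring
  have hErr : Err P w₁ w₂ = ∫ u, |f u - g u| ∂P :=
    integral_congr_ae (hP.mono fun u hu => by simp only [hfg u hu])
  have hmain := abs_integral_abs_sub_sub_le (P := P) (Q := empMeasure y) (ε := ε)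
    (fun t => by rw [← empCDF_eq_cdf hn]; exact h t) hf hg hfI hgI
  rw [← hErr, integral_empMeasure] at hmain
  have hn' : (0 : ℝ) < n := by positivity
  have hplug : |(1 / (n : ℝ)) * ∑ i, |f (y i) - g (y i)| - ErrHat y w₁ w₂| ≤ 4 * L * ε := by
    rw [ErrHat, ← mul_sub, ← Finset.sum_sub_distrib, abs_mul, abs_of_pos (by positivity),
      one_div_mul_eq_div, div_le_iff₀ hn']
    refine (Finset.abs_sum_le_sum_abs _ _).trans ?_
    have hterm : ∀ i ∈ Finset.univ, |(|f (y i) - g (y i)| -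
        |y i - 2 * w₁ * empCDF y (y i) - 2 * w₂ * (1 - empCDF y (y i))|)| ≤ 4 * L * ε := by
      intro i _
      refine (abs_abs_sub_abs_le_abs_sub _ _).trans ?_
      rw [hfg _ (hy i)]
      have e : y i - 2 * w₁ * cdf P (y i) - 2 * w₂ * (1 - cdf P (y i))
          - (y i - 2 * w₁ * empCDF y (y i) - 2 * w₂ * (1 - empCDF y (y i)))
          = (2 * (w₁ - w₂)) * (empCDF y (y i) - cdf P (y i)) := by ring
      rw [e, abs_mul]
      refine mul_le_mul ?_ (h _) (abs_nonneg _) (by linarith)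
      rw [abs_le]
      constructor <;> linarith
    refine (Finset.sum_le_sum hterm).trans_eq ?_
    simp [mul_comm]
  have h1 := abs_le.1 hmain
  have h2 := abs_le.1 hplug
  rw [abs_le]
  constructor <;> linarith

end Deterministic

/-! ### The uniform error bound -/

theorem mainTheorem5 (L : ℝ) :
    ∃ C : ℝ, 0 < C ∧
      ∀ (P : Measure ℝ) [IsProbabilityMeasure P], (∀ᵐ y ∂P, y ∈ Set.Icc (-L) L) →
      ∀ (Ω : Type*) [MeasurableSpace Ω] (μ : Measure Ω) [IsProbabilityMeasure μ]
        (n : ℕ) (Y : Fin n → Ω → ℝ),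
        0 < n → (∀ i, Measurable (Y i)) → (∀ i, HasLaw (Y i) P μ) → iIndepFun Y μ →
      ∀ δ : ℝ, 0 < δ → δ < 1 →
        ENNReal.ofReal (1 - 2 * δ) ≤
          μ {ω | ∀ w₁ ∈ Set.Icc (-L) L, ∀ w₂ ∈ Set.Icc (-L) L,
            |Err P w₁ w₂ - ErrHat (fun i => Y i ω) w₁ w₂| ≤
              C * Real.sqrt (Real.log (1 / δ) / n)} := by
  -- `64 = 32 * 2`, from taking `ε = 2r` below; `+ 1` ensures positivity when `L = 0`.
  refine ⟨64 * |L| + 1, by positivity, ?_⟩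
  intro P _ hP Ω _ μ _ n Y hn hm hl hi δ hδ0 hδ1
  rcases le_or_gt (1 / 2) δ with hδ | hδ
  · rw [ENNReal.ofReal_of_nonpos (by linarith)]
    exact zero_le
  have hn' : (0 : ℝ) < n := by positivity
  have hlog : 0 ≤ Real.log (1 / δ) := Real.log_nonneg (by rw [le_div_iff₀ hδ0]; linarith)
  set r := Real.sqrt (Real.log (1 / δ) / n) with hr
  have hr0 : 0 ≤ r := Real.sqrt_nonneg _
  -- With `ε = 2r` the failure probability is at most `4δ²`, which is at most `2δ` because `δ < 1/2`
  -- here.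
  have hexp : Real.exp (-(n * (2 * r) ^ 2 / 2)) = δ ^ 2 := by
    have : -(n * (2 * r) ^ 2 / 2) = Real.log δ + Real.log δ := by
      rw [mul_pow, hr, Real.sq_sqrt (by positivity), one_div, Real.log_inv]
      field_simp
      ring
    rw [this, Real.exp_add, Real.exp_log hδ0, sq]
  have hdkw := dvoretzky_kiefer_wolfowitz hm hl hi hn (ε := 2 * r) (by positivity)
  rw [hexp] at hdkw
  refine (ENNReal.ofReal_le_ofReal (by nlinarith)).trans (hdkw.trans ?_)
  have hY : ∀ᵐ ω ∂μ, ∀ i, Y i ω ∈ Set.Icc (-L) L := by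
    refine ae_all_iff.2 fun i => ?_
    have hPi := hP
    rw [← (hl i).map_eq] at hPi
    exact ae_of_ae_map (hm i).aemeasurable hPi
  refine measure_mono_ae (hY.mono fun ω hω h w₁ hw₁ w₂ hw₂ => ?_)
  refine (abs_Err_sub_ErrHat_le hP hn hω h hw₁ hw₂).trans ?_
  nlinarith [mul_le_mul_of_nonneg_right (le_abs_self L) hr0]
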